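/- All graphs are finite, simple and connected, and $d^G$ denotes the path metric of a graph $G$. A subgraph $G'$ of $G$ is isometric if it is connected and $d^{G'}(s,t)=d^G(s,t)$ for all nodes $s,t$ of $G'$. A graph $G$ is modular if every three nodes $s_0,s_1,s_2$ have a median, i.e. a node $z$ with $d^G(s_i,z)+d^G(z,s_j)=d^G(s_i,s_j)$ for all $0\le i<j\le 2$; it is hereditary modular if every isometric subgraph of $G$ is modular; and it is orientable if its edges can be oriented so that in every 4-circuit $v_0v_1v_2v_3v_0$ an edge $v_{i-1}v_i$ ($i=1,2$) is oriented from $v_{i-1}$ to $v_i$ if and only if its opposite edge $v_{i+1}v_{i+2}$ (with $v_4=v_0$) is oriented from $v_{i+2}$ to $v_{i+1}$. A frame is an orientable hereditary modular graph. Let $H_i=(T_i,U_i)$, $i=1,\ldots,k$, be frames, and let $K=H_1\times\cdots\times H_k$ be their Cartesian product: its node set is $T_1\times\cdots\times T_k$, and $(s_1,\ldots,s_k)$, $(t_1,\ldots,t_k)$ are adjacent if and only if there is an $i$ with $s_it_i\in U_i$ and $s_j=t_j$ for all $j\ne i$. For a subgraph $K'$ of $K$, an $i$-layer of $K'$ is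 a subgraph of $K'$ induced by all its nodes $(t_1,\ldots,t_k)$ with prescribed values of the coordinates $t_j$, $j\neq i$. Theorem. Let $K'$ be an isometric subgraph of $K$ such that $K'$ is modular and, for each $i=1,\ldots,k$, some $i$-layer of $K'$ is isomorphic to $H_i$. Then there exists a retraction of $K$ onto $K'$, that is, a mapping $\gamma:V(K)\to V(K')$ such that $\gamma(v)=v$ for all $v\in V(K')$ and $\gamma(u)\gamma(v)\in E(K')$ for all $uv\in E(K)$. -/

import Mathlib

namespace ModularRetract

/-- A graph is modular if it is connected and, with respect to its path metric, every three
vertices have a median. -/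
def IsModular {V : Type*} (G : SimpleGraph V) : Prop :=
  G.Connected ∧ ∀ s₀ s₁ s₂ : V, ∃ z : V,
    G.dist s₀ z + G.dist z s₁ = G.dist s₀ s₁ ∧
    G.dist s₀ z + G.dist z s₂ = G.dist s₀ s₂ ∧
    G.dist s₁ z + G.dist z s₂ = G.dist s₁ s₂

/-- A subgraph is isometric if it is connected (so that its path metric is defined) and its path
metric is the restriction of the path metric of the whole graph. -/
def IsIsometric {V : Type*} {G : SimpleGraph V} (G' : G.Subgraph) : Prop :=
  G'.coe.Connected ∧ ∀ s t : G'.verts, G'.coe.dist s t = G.dist (s : V) (t : V)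

/-- A connected graph all of whose isometric subgraphs are modular. -/
def IsHereditaryModular {V : Type*} (G : SimpleGraph V) : Prop :=
  G.Connected ∧ ∀ G' : G.Subgraph, IsIsometric G' → IsModular G'.coe

/-- `v₀ v₁ v₂ v₃` are, in this cyclic order, the (distinct) vertices of a 4-circuit of `G`. -/
def IsFourCircuit {V : Type*} (G : SimpleGraph V) (v₀ v₁ v₂ v₃ : V) : Prop :=
  G.Adj v₀ v₁ ∧ G.Adj v₁ v₂ ∧ G.Adj v₂ v₃ ∧ G.Adj v₃ v₀ ∧ v₀ ≠ v₂ ∧ v₁ ≠ v₃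

/-- The edges of `G` can be oriented (`o u v`: the edge `uv` is oriented from `u` to `v`; each edge
gets exactly one of its two directions) so that in every 4-circuit opposite edges are
oriented in the same way. -/
def IsOrientable {V : Type*} (G : SimpleGraph V) : Prop :=
  ∃ o : V → V → Prop,
    (∀ u v, G.Adj u v → ((o u v ∧ ¬ o v u) ∨ (o v u ∧ ¬ o u v))) ∧
    ∀ v₀ v₁ v₂ v₃, IsFourCircuit G v₀ v₁ v₂ v₃ →
      (o v₀ v₁ ↔ o v₃ v₂) ∧ (o v₁ v₂ ↔ o v₀ v₃)

/-- A frame is an orientable hereditary modular graph. -/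
def IsFrame {V : Type*} (G : SimpleGraph V) : Prop :=
  IsHereditaryModular G ∧ IsOrientable G

/-- The Cartesian product of a family of graphs: two vertices are adjacent iff they are adjacent in
one coordinate and agree in all the others. -/
def cartesianProduct {ι : Type*} {T : ι → Type*} (H : ∀ i, SimpleGraph (T i)) :
    SimpleGraph (∀ i, T i) where
  Adj s t := ∃ i, (H i).Adj (s i) (t i) ∧ ∀ j, j ≠ i → s j = t j
  symm := ⟨fun _ _ ⟨i, h, h'⟩ => ⟨i, h.symm, fun j hj => (h' j hj).symm⟩⟩
  loopless := ⟨fun _ ⟨_, h, _⟩ => h.ne rfl⟩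

/-- The `i`-layer of a subgraph `K'` of the product that is determined by fixing the coordinates
other than `i` to be those of `c` (the coordinate `c i` plays no role): the subgraph of `K'` induced
by all of its vertices with these coordinates. -/
def layer {ι : Type*} {T : ι → Type*} {H : ∀ i, SimpleGraph (T i)}
    (K' : (cartesianProduct H).Subgraph) (i : ι) (c : ∀ j, T j) :
    SimpleGraph {t : K'.verts | ∀ j, j ≠ i → (t : ∀ j, T j) j = c j} :=
  K'.coe.induce {t : K'.verts | ∀ j, j ≠ i → (t : ∀ j, T j) j = c j}

/-- `γ` is a retraction of `K` onto its subgraph `K'`: it is identical on the vertices of `K'` and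
brings each edge of `K` to an edge of `K'`. -/
def IsRetraction {V : Type*} {K : SimpleGraph V} (K' : K.Subgraph) (γ : V → K'.verts) : Prop :=
  (∀ v : K'.verts, γ (v : V) = v) ∧
    ∀ u v : V, K.Adj u v → K'.Adj (γ u : V) (γ v : V)

end ModularRetract

/-!
The proof reduces the theorem to pairs of factors and treats two factors by hand.

**Reduction to pairs.** Distances in the product are sums of coordinate distances, so medians in
`K'` are taken coordinatewise, and the vertex set `S` of `K'` is closed under coordinatewise
medians. By finiteness, an `i`-layer of `K'` isomorphic to `H i` is a full copy of `H i`. For each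
pair of coordinates let `R i j` be the projection of `S` to them (`pairRel`). Closure under medians
makes `S` decomposable in the sense of Baker and Pixley: a vertex all of whose pairs of coordinates
satisfy the relations `R i j` lies in `S` (`IsMedianClosed.mem_of_pairRel`). If every `R i j` is
the image of a retraction of `H i □ H j`, applied to the coordinates `i` and `j` these retractions
become endomorphisms of the product that fix `S`. Among all endomorphisms fixing `S` take one that
minimizes the sum of the distances between images and vertices of `S`; if it missed `S` somewhere,
composing it with one of the endomorphisms just described would lower the sum
(`exists_hom_retraction`).

**Two factors.** In a frame with a base point `c`, direct all edges away from `c`, writing `Low G c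
x y` if `x` is the lower end of the edge `xy`. The full layers of `S` supply base points for which
all slices of `R i j` are closed downwards, and closed under passing from two lower neighbours of a
vertex to this vertex (`IsLowClosed`). Such a relation `R` can be enlarged: `thicken` adds to a set
the vertices that have a lower neighbour in it, and those that are the top of a `K_{2,m}` whose
bottom (the *pole*) is in it. Doing this in both coordinates gives a strictly larger relation with
the same closure properties (`isLowClosedRel_thickenRel`), and moving both coordinates down by one
or both by two levels retracts the larger relation onto `R` (`slide_mem`, `slide_adj`). Iterating
from the full relation down to `R` gives the retraction (`exists_retraction_of_isLowClosedRel`).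

**Frames.** What the two-factor argument needs to know about the levels of a frame is collected in
`IsPolar`. It follows from modularity, from the absence of isometric hexagons
(`IsHereditaryModular.exists_diagonal`), and from the absence of `K_{3,3}` minus an edge, which has
no admissible orientation (`IsOrientable.no_thickK`).
-/

namespace ModularRetract

/-! ### Levels with respect to a base point, and sets closed downwards -/

/-- `Low G c x y`: the vertex `x` is a neighbour of `y` that lies one step closer to `c`. -/
def Low {V : Type*} (G : SimpleGraph V) (c x y : V) : Prop :=
  G.Adj x y ∧ G.dist c y = G.dist c x + 1

/-- The local structure of the levels of a graph around a vertex `c` that the retraction of two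
factors relies on. Every edge joins consecutive levels, and two lower neighbours `u`, `w` of a
vertex `x` have exactly one common lower neighbour `p`, which is below every lower neighbour of
`x`; this `p` is the pole of `x`, see `IsPole`. The field `no_wings` forbids that further lower
neighbours `s` of `u` and `t` of `w` have a common lower neighbour. -/
structure IsPolar {V : Type*} (G : SimpleGraph V) (c : V) : Prop where
  low_or_low : ∀ {x y}, G.Adj x y → Low G c x y ∨ Low G c y x
  exists_low : ∀ {x}, x ≠ c → ∃ x', Low G c x' x
  exists_meet : ∀ {x u w}, Low G c u x → Low G c w x → u ≠ w → ∃ p, Low G c p u ∧ Low G c p w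
  low_pole : ∀ {x u w v p}, Low G c u x → Low G c w x → u ≠ w → Low G c p u → Low G c p w →
    Low G c v x → Low G c p v
  pole_unique : ∀ {x u w p q}, Low G c u x → Low G c w x → u ≠ w → Low G c p u → Low G c p w →
    Low G c q u → Low G c q w → p = q
  no_wings : ∀ {x u w p s t r}, Low G c u x → Low G c w x → u ≠ w → Low G c p u → Low G c p w →
    Low G c s u → s ≠ p → Low G c t w → t ≠ p → Low G c r s → Low G c r t → False

/-- A set that contains the base point, is closed under passing to lower neighbours, and contains
every vertex with two lower neighbours in the set. -/
structure IsLowClosed {V : Type*} (G : SimpleGraph V) (c : V) (C : Set V) : Prop where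
  base : c ∈ C
  down : ∀ {x y}, Low G c x y → y ∈ C → x ∈ C
  join : ∀ {x u w}, Low G c u x → Low G c w x → u ≠ w → u ∈ C → w ∈ C → x ∈ C

/-- `g` is the pole of `x`: the common lower neighbour of two lower neighbours of `x`. A vertex with
only one lower neighbour has no pole. -/
def IsPole {V : Type*} (G : SimpleGraph V) (c g x : V) : Prop :=
  ∃ u w, u ≠ w ∧ Low G c u x ∧ Low G c w x ∧ Low G c g u ∧ Low G c g w

/-- The vertex `x` has a lower neighbour in `C`. -/
def HasLow {V : Type*} (G : SimpleGraph V) (c : V) (C : Set V) (x : V) : Prop :=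
  ∃ g ∈ C, Low G c g x

/-- The vertex `x` has a pole in `C`. -/
def HasPole {V : Type*} (G : SimpleGraph V) (c : V) (C : Set V) (x : V) : Prop :=
  ∃ g ∈ C, IsPole G c g x

/-- The set `C` together with the vertices that have a lower neighbour or a pole in `C`. -/
def thicken {V : Type*} (G : SimpleGraph V) (c : V) (C : Set V) : Set V :=
  {x | x ∈ C ∨ HasLow G c C x ∨ HasPole G c C x}

section OneFactor

variable {V : Type*} {G : SimpleGraph V} {c : V} {C : Set V}

theorem thicken_mono {C D : Set V} (h : C ⊆ D) : thicken G c C ⊆ thicken G c D := by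
  rintro x (hx | ⟨g, hg, hx⟩ | ⟨g, hg, hx⟩)
  · exact .inl (h hx)
  · exact .inr (.inl ⟨g, h hg, hx⟩)
  · exact .inr (.inr ⟨g, h hg, hx⟩)

theorem IsLowClosed.low_unique (hC : IsLowClosed G c C) {x u w : V} (hx : x ∉ C)
    (hu : Low G c u x) (huC : u ∈ C) (hw : Low G c w x) (hwC : w ∈ C) : u = w := by
  by_contra h
  exact hx (hC.join hu hw h huC hwC)

theorem IsPolar.low_of_isPole (hG : IsPolar G c) {g x v : V} (hg : IsPole G c g x)
    (hv : Low G c v x) : Low G c g v := by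
  obtain ⟨u, w, h, hu, hw, hgu, hgw⟩ := hg
  exact hG.low_pole hu hw h hgu hgw hv

theorem IsPolar.isPole_unique (hG : IsPolar G c) {g g' x : V} (hg : IsPole G c g x)
    (hg' : IsPole G c g' x) : g = g' := by
  obtain ⟨u, w, h, hu, hw, hgu, hgw⟩ := hg
  exact hG.pole_unique hu hw h hgu hgw (hG.low_of_isPole hg' hu) (hG.low_of_isPole hg' hw)

theorem IsLowClosed.meet (hC : IsLowClosed G c C) (hG : IsPolar G c) {x u w : V}
    (hu : Low G c u x) (hw : Low G c w x) (h : u ≠ w) (hwC : w ∈ C) :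
    ∃ p ∈ C, Low G c p u ∧ Low G c p w := by
  obtain ⟨p, hpu, hpw⟩ := hG.exists_meet hu hw h
  exact ⟨p, hC.down hpw hwC, hpu, hpw⟩

theorem IsPole.other {g x : V} (hg : IsPole G c g x) (p : V) :
    ∃ s, s ≠ p ∧ Low G c s x ∧ Low G c g s := by
  obtain ⟨u, w, h, hu, hw, hgu, hgw⟩ := hg
  by_cases hp : u = p
  · exact ⟨w, fun e => h (hp.trans e.symm), hw, hgw⟩
  · exact ⟨u, hp, hu, hgu⟩

theorem IsLowClosed.pole_mem (hC : IsLowClosed G c C) {g x : V} (hg : IsPole G c g x)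
    (hx : x ∈ C) : g ∈ C := by
  obtain ⟨s, -, hs, hgs⟩ := hg.other x
  exact hC.down hgs (hC.down hs hx)

theorem thicken_down (hG : IsPolar G c) (hC : IsLowClosed G c C) {x y : V} (h : Low G c x y)
    (hy : y ∈ thicken G c C) : x ∈ thicken G c C := by
  rcases hy with hy | ⟨g, hg, hy⟩ | ⟨g, hg, hy⟩
  · exact .inl (hC.down h hy)
  · by_cases e : x = g
    · exact .inl (e ▸ hg)
    · obtain ⟨p, hp, hpx, -⟩ := hC.meet hG h hy e hg
      exact .inr (.inl ⟨p, hp, hpx⟩)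
  · exact .inr (.inl ⟨g, hg, hG.low_of_isPole hy h⟩)

theorem thicken_join (hG : IsPolar G c) (hC : IsLowClosed G c C) {x u w : V}
    (hu : Low G c u x) (hw : Low G c w x) (h : u ≠ w) (huC : u ∈ thicken G c C)
    (hwC : w ∈ thicken G c C) : x ∈ thicken G c C := by
  by_cases hu0 : u ∈ C
  · exact .inr (.inl ⟨u, hu0, hu⟩)
  by_cases hw0 : w ∈ C
  · exact .inr (.inl ⟨w, hw0, hw⟩)
  obtain ⟨p, hpu, hpw⟩ := hG.exists_meet hu hw h
  by_cases hp : p ∈ C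
  · exact .inr (.inr ⟨p, hp, u, w, h, hu, hw, hpu, hpw⟩)
  -- above `p`, both `u` and `w` have a second lower neighbour with a common lower neighbour in `C`
  have key : ∀ {v}, v ∈ thicken G c C → v ∉ C → Low G c p v →
      ∃ s r, r ∈ C ∧ s ≠ p ∧ Low G c s v ∧ Low G c r p ∧ Low G c r s := by
    intro v hv hv0 hpv
    rcases hv with hv | ⟨g, hg, hv⟩ | ⟨g, hg, hv⟩
    · exact absurd hv hv0
    · have e : p ≠ g := fun e => hp (e ▸ hg)
      obtain ⟨r, hr, hrp, hrg⟩ := hC.meet hG hpv hv e hg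
      exact ⟨g, r, hr, e.symm, hv, hrp, hrg⟩
    · obtain ⟨s, hs, hsv, hgs⟩ := hv.other p
      exact ⟨s, g, hg, hs, hsv, hG.low_of_isPole hv hpv, hgs⟩
  obtain ⟨s, r, hr, hsp, hsu, hrp, hrs⟩ := key huC hu0 hpu
  obtain ⟨t, r', hr', htp, htw, hrp', hrt⟩ := key hwC hw0 hpw
  obtain rfl := hC.low_unique hp hrp hr hrp' hr'
  exact (hG.no_wings hu hw h hpu hpw hsu hsp htw htp hrs hrt).elim

/-- Thickening commutes with intersections of closed sets, since two different lower neighbours of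
`x` in the two sets produce a pole of `x` in the intersection. -/
theorem thicken_inter (hG : IsPolar G c) {D : Set V} (hC : IsLowClosed G c C)
    (hD : IsLowClosed G c D) :
    thicken G c C ∩ thicken G c D ⊆ thicken G c (C ∩ D) := by
  have pole_mem : ∀ {E : Set V}, IsLowClosed G c E → ∀ {g v x}, IsPole G c g x → Low G c v x →
      v ∈ E → g ∈ E := fun hE _ _ _ hg hv hvE => hE.down (hG.low_of_isPole hg hv) hvE
  rintro x ⟨hx | ⟨g, hg, hx⟩ | ⟨g, hg, hx⟩, hx' | ⟨g', hg', hx'⟩ | ⟨g', hg', hx'⟩⟩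
  · exact .inl ⟨hx, hx'⟩
  · exact .inr (.inl ⟨g', ⟨hC.down hx' hx, hg'⟩, hx'⟩)
  · exact .inr (.inr ⟨g', ⟨hC.pole_mem hx' hx, hg'⟩, hx'⟩)
  · exact .inr (.inl ⟨g, ⟨hg, hD.down hx hx'⟩, hx⟩)
  · by_cases e : g = g'
    · exact .inr (.inl ⟨g, ⟨hg, e ▸ hg'⟩, hx⟩)
    · obtain ⟨p, hpg, hpg'⟩ := hG.exists_meet hx hx' e
      exact .inr (.inr ⟨p, ⟨hC.down hpg hg, hD.down hpg' hg'⟩, g, g', e, hx, hx', hpg, hpg'⟩)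
  · exact .inr (.inr ⟨g', ⟨pole_mem hC hx' hx hg, hg'⟩, hx'⟩)
  · exact .inr (.inr ⟨g, ⟨hg, hD.pole_mem hx hx'⟩, hx⟩)
  · exact .inr (.inr ⟨g, ⟨hg, pole_mem hD hx hx' hg'⟩, hx⟩)
  · obtain rfl := hG.isPole_unique hx hx'
    exact .inr (.inr ⟨g, ⟨hg, hg'⟩, hx⟩)

open Classical in
/-- The vertex of `C` below a vertex `x` of `thicken G c C` outside `C`: the lower neighbour of `x`
in `C` if there is one, otherwise the pole of `x`. The value in other cases plays no role. -/
noncomputable def foot (G : SimpleGraph V) (c : V) (C : Set V) (x : V) : V :=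
  if h : HasLow G c C x then h.choose else if h : HasPole G c C x then h.choose else x

theorem HasLow.foot_mem (h : HasLow G c C x) : foot G c C x ∈ C ∧ Low G c (foot G c C x) x := by
  rw [foot, dif_pos h]
  exact h.choose_spec

theorem HasLow.foot_eq (hC : IsLowClosed G c C) {x g : V} (hx : x ∉ C) (hg : g ∈ C)
    (h : Low G c g x) : foot G c C x = g :=
  have hf := HasLow.foot_mem ⟨g, hg, h⟩
  hC.low_unique hx hf.2 hf.1 h hg

theorem foot_pole {x : V} (hx : x ∈ thicken G c C) (hx0 : x ∉ C) (h : ¬ HasLow G c C x) :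
    foot G c C x ∈ C ∧ IsPole G c (foot G c C x) x := by
  have h' : HasPole G c C x := by rcases hx with hx | hx | hx <;> tauto
  rw [foot, dif_neg h, dif_pos h']
  exact h'.choose_spec

open Classical in
/-- An arbitrary lower neighbour of `x`, and `x` itself if there is none. -/
noncomputable def someLow (G : SimpleGraph V) (c x : V) : V :=
  if h : ∃ y, Low G c y x then h.choose else x

theorem low_someLow {x y : V} (h : Low G c y x) : Low G c (someLow G c x) x := by
  have h' : ∃ y, Low G c y x := ⟨y, h⟩
  rw [someLow, dif_pos h']
  exact h'.choose_spec

end OneFactor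

/-! ### Retractions of a product of two factors -/

section TwoFactors

variable {V W : Type*} {G : SimpleGraph V} {H : SimpleGraph W} {c : V} {d : W}

/-- All slices of the relation, in both coordinates, are closed. -/
def IsLowClosedRel (G : SimpleGraph V) (H : SimpleGraph W) (c : V) (d : W) (R : V → W → Prop) :
    Prop :=
  (∀ y, IsLowClosed G c {x | R x y}) ∧ ∀ x, IsLowClosed H d {y | R x y}

theorem IsLowClosedRel.flip {R : V → W → Prop} (hR : IsLowClosedRel G H c d R) :
    IsLowClosedRel H G d c (fun y x => R x y) := ⟨hR.2, hR.1⟩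

/-- The pairs each of whose coordinates lies in the thickening of the slice through the other. -/
def thickenRel (G : SimpleGraph V) (H : SimpleGraph W) (c : V) (d : W) (R : V → W → Prop) :
    V → W → Prop :=
  fun x y => x ∈ thicken G c {x | R x y} ∧ y ∈ thicken H d {y | R x y}

theorem thickenRel_of {R : V → W → Prop} {x : V} {y : W} (h : R x y) :
    thickenRel G H c d R x y := ⟨.inl h, .inl h⟩

theorem isLowClosed_thickenRel (hG : IsPolar G c) (hH : IsPolar H d) {R : V → W → Prop}
    (hR : IsLowClosedRel G H c d R) (y : W) :
    IsLowClosed G c {x | thickenRel G H c d R x y} where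
  base := thickenRel_of (hR.1 y).base
  down := fun h hx => ⟨thicken_down hG (hR.1 y) h hx.1,
    thicken_mono (fun y' hy' => (hR.1 y').down h hy') hx.2⟩
  join := fun {_ u w} hu hw h hx hx' => ⟨thicken_join hG (hR.1 y) hu hw h hx.1 hx'.1,
    thicken_mono (fun y' hy' => (hR.1 y').join hu hw h hy'.1 hy'.2)
      (thicken_inter hH (hR.2 u) (hR.2 w) ⟨hx.2, hx'.2⟩)⟩

theorem isLowClosedRel_thickenRel (hG : IsPolar G c) (hH : IsPolar H d) {R : V → W → Prop}
    (hR : IsLowClosedRel G H c d R) : IsLowClosedRel G H c d (thickenRel G H c d R) := by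
  refine ⟨isLowClosed_thickenRel hG hH hR, fun x => ?_⟩
  convert isLowClosed_thickenRel hH hG hR.flip x using 3
  exact and_comm

open Classical in
/-- The first coordinate of the image of `(x, y)` under the retraction of `thickenRel G H c d R`
onto `R`; the second one is obtained by exchanging the factors. Pairs in `R` are fixed. If both
coordinates or neither have a lower neighbour in their slice, both move to their feet. If only `y`
has one, then `y` moves down by one level to its foot; so that the sum of the two moves stays
even, `x` moves down by one level as well, and any lower neighbour will do since `R` is closed
downwards. -/
noncomputable def slide (G : SimpleGraph V) (H : SimpleGraph W) (c : V) (d : W)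
    (R : V → W → Prop) (x : V) (y : W) : V :=
  if R x y then x
  else if HasLow H d {y | R x y} y ∧ ¬ HasLow G c {x | R x y} x then someLow G c x
  else foot G c {x | R x y} x

theorem slide_of {R : V → W → Prop} {x : V} {y : W} (h : R x y) : slide G H c d R x y = x :=
  if_pos h

theorem slide_eq_foot {R : V → W → Prop} {x : V} {y : W} (h : ¬ R x y)
    (h' : HasLow G c {x | R x y} x ∨ ¬ HasLow H d {y | R x y} y) :
    slide G H c d R x y = foot G c {x | R x y} x := by
  rw [slide, if_neg h, if_neg (by tauto)]

theorem slide_eq_someLow {R : V → W → Prop} {x : V} {y : W} (h : ¬ R x y)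
    (h' : ¬ HasLow G c {x | R x y} x) (h'' : HasLow H d {y | R x y} y) :
    slide G H c d R x y = someLow G c x := by
  rw [slide, if_neg h, if_pos ⟨h'', h'⟩]

theorem slide_mem {R : V → W → Prop} (hR : IsLowClosedRel G H c d R)
    {x : V} {y : W} (h : thickenRel G H c d R x y) :
    R (slide G H c d R x y) (slide H G d c (fun y x => R x y) y x) := by
  by_cases hz : R x y
  · rwa [slide_of hz, slide_of (R := fun y x => R x y) hz]
  by_cases hx : HasLow G c {x | R x y} x <;> by_cases hy : HasLow H d {y | R x y} y
  · rw [slide_eq_foot hz (.inl hx), slide_eq_foot (R := fun y x => R x y) hz (.inl hy)]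
    exact (hR.2 _).down hy.foot_mem.2 hx.foot_mem.1
  · have hy' := foot_pole h.2 hz hy
    obtain ⟨s, -, hs, -⟩ := hy'.2.other y
    rw [slide_eq_foot hz (.inl hx), slide_eq_someLow (R := fun y x => R x y) hz hy hx]
    exact (hR.2 _).down (low_someLow hs) hx.foot_mem.1
  · have hx' := foot_pole h.1 hz hx
    obtain ⟨s, -, hs, -⟩ := hx'.2.other x
    rw [slide_eq_someLow hz hx hy, slide_eq_foot (R := fun y x => R x y) hz (.inl hy)]
    exact (hR.1 _).down (low_someLow hs) hy.foot_mem.1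
  · rw [slide_eq_foot hz (.inr hy), slide_eq_foot (R := fun y x => R x y) hz (.inr hx)]
    exact (hR.2 _).pole_mem (foot_pole h.2 hz hy).2 (foot_pole h.1 hz hx).1

/-- The retraction preserves edges in the first coordinate. If both ends `(x, y)` and `(x', y)` lie
outside `R`, the lower end `x'` has its foot directly below it, and it matters which of `x` and `y`
have lower neighbours in the slices through the other. -/
theorem slide_adj (hG : IsPolar G c) (hH : IsPolar H d) {R : V → W → Prop}
    (hR : IsLowClosedRel G H c d R) {x x' : V} {y : W} (hx : Low G c x' x)
    (h : thickenRel G H c d R x y) :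
    (G □ H).Adj (slide G H c d R x y, slide H G d c (fun y x => R x y) y x)
      (slide G H c d R x' y, slide H G d c (fun y x => R x y) y x') := by
  rw [SimpleGraph.boxProd_adj]
  dsimp only
  by_cases hz : R x y
  · have hz' : R x' y := (hR.1 y).down hx hz
    rw [slide_of hz, slide_of (R := fun y x => R x y) hz, slide_of hz',
      slide_of (R := fun y x => R x y) hz']
    exact .inl ⟨hx.1.symm, rfl⟩
  have hC := hR.1 y
  have someLow_y : ¬ HasLow H d {y | R x y} y → Low H d (someLow H d y) y := fun hy => by
    obtain ⟨s, -, hs, -⟩ := (foot_pole h.2 hz hy).2.other y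
    exact low_someLow hs
  by_cases hz' : R x' y
  · have hx1 : HasLow G c {x | R x y} x := ⟨x', hz', hx⟩
    rw [slide_of hz', slide_of (R := fun y x => R x y) hz', slide_eq_foot hz (.inl hx1),
      HasLow.foot_eq hC hz hz' hx]
    refine .inr ⟨?_, rfl⟩
    by_cases hy : HasLow H d {y | R x y} y
    · rw [slide_eq_foot (R := fun y x => R x y) hz (.inl hy)]
      exact hy.foot_mem.2.1
    · rw [slide_eq_someLow (R := fun y x => R x y) hz hy hx1]
      exact (someLow_y hy).1
  have h' := (isLowClosed_thickenRel hG hH hR y).down hx h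
  have hsub : {y | R x y} ⊆ {y | R x' y} := fun y' hy' => (hR.1 y').down hx hy'
  -- the first coordinate of the lower pair always has its foot directly below it
  have hx1' : HasLow G c {x | R x y} x' := by
    by_cases hx1 : HasLow G c {x | R x y} x
    · obtain ⟨hf, hfx⟩ := hx1.foot_mem
      obtain ⟨p, hp, hpx, -⟩ := hC.meet hG hx hfx (fun e => hz' (e ▸ hf)) hf
      exact ⟨p, hp, hpx⟩
    · obtain ⟨hf, hfx⟩ := foot_pole h.1 hz hx1
      exact ⟨_, hf, hG.low_of_isPole hfx hx⟩
  by_cases hy : HasLow H d {y | R x y} y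
  · have hy' : HasLow H d {y | R x' y} y := by
      obtain ⟨g, hg, hgy⟩ := hy
      exact ⟨g, hsub hg, hgy⟩
    have hfy : foot H d {y | R x' y} y = foot H d {y | R x y} y :=
      HasLow.foot_eq (hR.2 x') hz' (hsub hy.foot_mem.1) hy.foot_mem.2
    rw [slide_eq_foot (R := fun y x => R x y) hz (.inl hy),
      slide_eq_foot (R := fun y x => R x y) hz' (.inl hy'), slide_eq_foot hz' (.inl hx1'), hfy]
    refine .inl ⟨?_, rfl⟩
    by_cases hx1 : HasLow G c {x | R x y} x
    · obtain ⟨hf, hfx⟩ := hx1.foot_mem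
      obtain ⟨p, hp, hpx, hpf⟩ := hC.meet hG hx hfx (fun e => hz' (e ▸ hf)) hf
      rw [slide_eq_foot hz (.inl hx1), HasLow.foot_eq hC hz' hp hpx]
      exact hpf.1.symm
    · obtain ⟨hf, hfx⟩ := foot_pole h.1 hz hx1
      rw [slide_eq_someLow hz hx1 hy, HasLow.foot_eq hC hz' hf (hG.low_of_isPole hfx hx)]
      exact (hG.low_of_isPole hfx (low_someLow hx)).1.symm
  obtain ⟨hf, hfy⟩ := foot_pole h.2 hz hy
  by_cases hx1 : HasLow G c {x | R x y} x
  · obtain ⟨hg, hgx⟩ := hx1.foot_mem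
    obtain ⟨p, hp, hpx, hpf⟩ := hC.meet hG hx hgx (fun e => hz' (e ▸ hg)) hg
    have hy' : ¬ HasLow H d {y | R x' y} y := by
      rintro ⟨g', hg', hgy'⟩
      exact hy ⟨g', (hR.1 g').join hx hgx (fun e => hz' (e ▸ hg)) hg' ((hR.2 _).down hgy' hg),
        hgy'⟩
    rw [slide_eq_someLow (R := fun y x => R x y) hz hy hx1,
      slide_eq_someLow (R := fun y x => R x y) hz' hy' hx1', slide_eq_foot hz (.inl hx1),
      slide_eq_foot hz' (.inl hx1'), HasLow.foot_eq hC hz' hp hpx]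
    exact .inl ⟨hpf.1.symm, rfl⟩
  · obtain ⟨hg, hgx⟩ := foot_pole h.1 hz hx1
    rw [slide_eq_foot (R := fun y x => R x y) hz (.inr hx1), slide_eq_foot hz (.inr hy),
      slide_eq_foot hz' (.inl hx1'), HasLow.foot_eq hC hz' hg (hG.low_of_isPole hgx hx)]
    refine .inr ⟨?_, rfl⟩
    by_cases hy' : HasLow H d {y | R x' y} y
    · rw [slide_eq_foot (R := fun y x => R x y) hz' (.inl hy')]
      exact (hH.low_of_isPole hfy hy'.foot_mem.2).1
    · rw [slide_eq_someLow (R := fun y x => R x y) hz' hy' hx1']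
      exact (hH.low_of_isPole hfy (someLow_y hy)).1

/-- A relation between the vertices of two factors all of whose slices are closed is the image of an
endomorphism of the box product that fixes it. The induction is on the number of pairs outside the
relation. -/
theorem exists_retraction_of_isLowClosedRel [Finite V] [Finite W] (hG : IsPolar G c)
    (hH : IsPolar H d) {R : V → W → Prop} (hR : IsLowClosedRel G H c d R) :
    ∃ γ : V × W → V × W, (∀ z, R (γ z).1 (γ z).2) ∧ (∀ z, R z.1 z.2 → γ z = z) ∧
      ∀ z z', (G □ H).Adj z z' → (G □ H).Adj (γ z) (γ z') := by
  obtain ⟨n, hn⟩ : ∃ n, Set.ncard {z : V × W | ¬ R z.1 z.2} ≤ n := ⟨_, le_rfl⟩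
  induction n generalizing R with
  | zero =>
    have hall : ∀ x y, R x y := by
      intro x y
      by_contra hxy
      have := (Set.ncard_eq_zero (Set.toFinite _)).1 (Nat.le_zero.1 hn)
      exact (this ▸ hxy : (x, y) ∈ (∅ : Set (V × W)))
    exact ⟨id, fun z => hall _ _, fun z _ => rfl, fun z z' h => h⟩
  | succ n ih =>
    by_cases hall : ∀ x y, R x y
    · exact ⟨id, fun z => hall _ _, fun z _ => rfl, fun z z' h => h⟩
    obtain ⟨x, y, hxy, hmin⟩ : ∃ x y, ¬ R x y ∧
        ∀ x' y', G.dist c x' + H.dist d y' < G.dist c x + H.dist d y → R x' y' := by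
      push Not at hall
      obtain ⟨x, y, hxy⟩ := hall
      obtain ⟨z, hz, hz'⟩ := WellFounded.has_min
        (measure fun z : V × W => G.dist c z.1 + H.dist d z.2).wf {z | ¬ R z.1 z.2} ⟨(x, y), hxy⟩
      refine ⟨z.1, z.2, hz, fun x' y' h => ?_⟩
      by_contra h'
      exact hz' (x', y') h' h
    -- a lowest pair outside `R` lies in the thickening, which is therefore strictly larger
    have hthick : thickenRel G H c d R x y := by
      constructor
      · obtain ⟨x', hx'⟩ := hG.exists_low (x := x) (fun e => hxy (e ▸ (hR.1 y).base))
        exact .inr (.inl ⟨x', hmin _ _ (by have := hx'.2; omega), hx'⟩)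
      · obtain ⟨y', hy'⟩ := hH.exists_low (x := y) (fun e => hxy (e ▸ (hR.2 x).base))
        exact .inr (.inl ⟨y', hmin _ _ (by have := hy'.2; omega), hy'⟩)
    obtain ⟨γ, hγ, hfix, hadj⟩ := ih (isLowClosedRel_thickenRel hG hH hR) (by
      refine Nat.le_of_lt_succ (lt_of_lt_of_le (Set.ncard_lt_ncard ?_ (Set.toFinite _)) hn)
      refine Set.ssubset_iff_subset_ne.2 ⟨fun z hz h => hz (thickenRel_of h), fun e => ?_⟩
      have : (x, y) ∈ {z : V × W | ¬ R z.1 z.2} := hxy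
      rw [← e] at this
      exact this hthick)
    refine ⟨fun z => (slide G H c d R (γ z).1 (γ z).2,
      slide H G d c (fun y x => R x y) (γ z).2 (γ z).1), fun z => slide_mem hR (hγ z),
      fun z hz => ?_, fun z z' h => ?_⟩
    · dsimp only
      rw [hfix z (thickenRel_of hz), slide_of hz, slide_of (R := fun y x => R x y) hz]
    · dsimp only
      have hz := hγ z
      have hz' := hγ z'
      have h := hadj z z' h
      generalize γ z = w at *
      generalize γ z' = w' at *
      obtain ⟨x, y⟩ := w
      obtain ⟨x', y'⟩ := w'
      rw [SimpleGraph.boxProd_adj] at h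
      rcases h with ⟨h, rfl : y = y'⟩ | ⟨h, rfl : x = x'⟩
      · rcases hG.low_or_low h with h | h
        · exact (slide_adj hG hH hR h hz').symm
        · exact slide_adj hG hH hR h hz
      · have swap : ∀ {a b : V} {a' b' : W}, (H □ G).Adj (a', a) (b', b) →
            (G □ H).Adj (a, a') (b, b') := fun h => by
          rw [SimpleGraph.boxProd_adj] at h ⊢
          tauto
        rcases hH.low_or_low h with h | h
        · exact (swap (slide_adj hH hG hR.flip h hz'.symm)).symm
        · exact swap (slide_adj hH hG hR.flip h hz.symm)

end TwoFactors

/-! ### Levels of frames -/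

section Modular

variable {V : Type*} {G : SimpleGraph V}

/-- Modular graphs are bipartite: the perimeter of a triple is twice the sum of the distances to a
median. -/
theorem IsModular.even_dist (hG : IsModular G) (x y c : V) :
    Even (G.dist x y + G.dist c x + G.dist c y) := by
  obtain ⟨z, h1, h2, h3⟩ := hG.2 x y c
  rw [Nat.even_iff]
  have e1 := G.dist_comm (u := z) (v := y)
  have e2 := G.dist_comm (u := c) (v := x)
  have e3 := G.dist_comm (u := c) (v := y)
  omega

theorem IsModular.low_or_low (hG : IsModular G) (c : V) {x y : V} (h : G.Adj x y) :
    Low G c x y ∨ Low G c y x := by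
  have h1 := SimpleGraph.dist_eq_one_iff_adj.2 h
  have h2 := Nat.even_iff.1 (hG.even_dist x y c)
  have h3 := hG.1.dist_triangle (u := c) (v := x) (w := y)
  have h4 := hG.1.dist_triangle (u := c) (v := y) (w := x)
  rw [SimpleGraph.dist_comm (u := y)] at h4
  have : G.dist c y = G.dist c x + 1 ∨ G.dist c x = G.dist c y + 1 := by omega
  exact this.imp (fun e => ⟨h, e⟩) (fun e => ⟨h.symm, e⟩)

theorem exists_adj_dist_add_one (hG : G.Connected) {x y : V} (h : x ≠ y) :
    ∃ z, G.Adj x z ∧ G.dist z y + 1 = G.dist x y := by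
  obtain ⟨p, hp⟩ := hG.exists_walk_length_eq_dist x y
  cases p with
  | nil => exact absurd rfl h
  | @cons _ z _ hz q =>
    refine ⟨z, hz, ?_⟩
    have h1 := SimpleGraph.dist_le q
    have h2 := hG.dist_triangle (u := x) (v := z) (w := y)
    rw [SimpleGraph.dist_eq_one_iff_adj.2 hz] at h2
    rw [SimpleGraph.Walk.length_cons] at hp
    omega

theorem exists_low_of_ne (hG : G.Connected) {c x : V} (h : x ≠ c) : ∃ x', Low G c x' x := by
  obtain ⟨z, hz, hd⟩ := exists_adj_dist_add_one hG h
  refine ⟨z, hz.symm, ?_⟩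
  rw [G.dist_comm, ← hd, G.dist_comm]

theorem IsModular.dist_eq_two (hG : IsModular G) {x u w : V} (hu : G.Adj u x) (hw : G.Adj w x)
    (h : u ≠ w) : G.dist u w = 2 := by
  have h1 := SimpleGraph.dist_eq_one_iff_adj.2 hu
  have h2 := SimpleGraph.dist_eq_one_iff_adj.2 hw
  have h3 := hG.1.dist_triangle (u := u) (v := x) (w := w)
  have h4 := hG.1.pos_dist_of_ne h
  have h5 := Nat.even_iff.1 (hG.even_dist u w x)
  rw [G.dist_comm] at h1 h2
  rw [G.dist_comm (u := x) (v := w)] at *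
  rw [G.dist_comm (u := x) (v := u)] at *
  omega

theorem IsModular.exists_meet (hG : IsModular G) {c x u w : V} (hu : Low G c u x)
    (hw : Low G c w x) (h : u ≠ w) : ∃ p, Low G c p u ∧ Low G c p w := by
  obtain ⟨p, h1, h2, h3⟩ := hG.2 u w c
  have h4 := hG.dist_eq_two hu.1 hw.1 h
  have h5 := hu.2
  have h6 := hw.2
  rw [G.dist_comm (u := p) (v := w)] at h1
  rw [G.dist_comm (u := u) (v := c), G.dist_comm (u := p) (v := c)] at h2
  rw [G.dist_comm (u := w) (v := c), G.dist_comm (u := p) (v := c)] at h3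
  have h7 : G.dist u p = 1 := by omega
  have h8 : G.dist w p = 1 := by omega
  exact ⟨p, ⟨(SimpleGraph.dist_eq_one_iff_adj.1 h7).symm, by omega⟩,
    ⟨(SimpleGraph.dist_eq_one_iff_adj.1 h8).symm, by omega⟩⟩

end Modular

section Induced

variable {V : Type*} {G : SimpleGraph V}

/-- Homomorphisms do not increase distances. -/
theorem dist_map_le {W : Type*} {H : SimpleGraph W} (hH : H.Connected) (f : H →g G) (x y : W) :
    G.dist (f x) (f y) ≤ H.dist x y := by
  obtain ⟨p, hp⟩ := hH.exists_walk_length_eq_dist x y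
  rw [← hp, ← p.length_map f]
  exact SimpleGraph.dist_le _

/-- If every vertex other than `t` has a neighbour at which `f` is smaller by one, then descending
along such neighbours gives walks to `t` of length `f`. -/
theorem exists_walk_length_eq {t : V} {f : V → ℕ} (h0 : f t = 0)
    (h : ∀ s, s ≠ t → ∃ r, G.Adj s r ∧ f r + 1 = f s) (s : V) :
    ∃ p : G.Walk s t, p.length = f s := by
  induction hn : f s generalizing s with
  | zero =>
    by_cases hst : s = t
    · subst hst
      exact ⟨.nil, rfl⟩
    · obtain ⟨r, -, hr⟩ := h s hst
      omega
  | succ n ih =>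
    obtain ⟨r, hr, hfr⟩ := h s (by rintro rfl; omega)
    obtain ⟨p, hp⟩ := ih r (by omega)
    exact ⟨.cons hr p, by rw [SimpleGraph.Walk.length_cons, hp]⟩

/-- An induced subgraph is isometric if one can always step inside it towards a prescribed vertex
of it. -/
theorem isIsometric_induce {S : Set V} (hS : S.Nonempty)
    (h : ∀ s ∈ S, ∀ t ∈ S, s ≠ t → ∃ r ∈ S, G.Adj s r ∧ G.dist r t + 1 = G.dist s t) :
    IsIsometric ((⊤ : G.Subgraph).induce S) := by
  set K := (⊤ : G.Subgraph).induce S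
  have key : ∀ s t : K.verts, ∃ p : K.coe.Walk s t, p.length = G.dist (s : V) t := fun s t =>
    exists_walk_length_eq (f := fun s : K.verts => G.dist (s : V) t) SimpleGraph.dist_self
      (fun s hst => by
        obtain ⟨r, hr, hsr, hrt⟩ := h s s.2 t t.2 (Subtype.coe_injective.ne hst)
        exact ⟨⟨r, hr⟩, ⟨s.2, hr, hsr⟩, hrt⟩) s
  have hconn : K.coe.Connected := by
    have : Nonempty K.verts := hS.to_subtype
    exact ⟨fun s t => (key s t).choose.reachable⟩
  refine ⟨hconn, fun s t => le_antisymm ?_ (dist_map_le hconn K.hom s t)⟩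
  obtain ⟨p, hp⟩ := key s t
  exact hp ▸ SimpleGraph.dist_le p

theorem IsHereditaryModular.isModular (hG : IsHereditaryModular G) : IsModular G := by
  have := hG.1.nonempty
  have hiso := isIsometric_induce (S := Set.univ) Set.univ_nonempty (fun s _ t _ hst => by
    obtain ⟨r, hr⟩ := exists_adj_dist_add_one hG.1 hst
    exact ⟨r, trivial, hr⟩)
  have hmod := hG.2 _ hiso
  refine ⟨hG.1, fun x y z => ?_⟩
  obtain ⟨m, h⟩ := hmod.2 ⟨x, trivial⟩ ⟨y, trivial⟩ ⟨z, trivial⟩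
  simp only [hiso.2] at h
  exact ⟨m, h⟩

theorem zmod_six_cases (i : ZMod 6) : i = 0 ∨ i = 1 ∨ i = 2 ∨ i = 3 ∨ i = 4 ∨ i = 5 := by
  revert i
  decide

/-- A hereditary modular graph has no isometric hexagon: such a hexagon would be a modular graph,
but three pairwise non-adjacent vertices of a hexagon have no median in it. -/
theorem IsHereditaryModular.no_hexagon (hG : IsHereditaryModular G) (v : ZMod 6 → V)
    (hadj : ∀ i, G.Adj (v i) (v (i + 1))) (hdist : ∀ i, G.dist (v i) (v (i + 3)) = 3) : False := by
  have d1 : ∀ i, G.dist (v i) (v (i + 1)) = 1 := fun i =>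
    SimpleGraph.dist_eq_one_iff_adj.2 (hadj i)
  have d2 : ∀ i, G.dist (v i) (v (i + 2)) = 2 := by
    intro i
    have h1 := hG.1.dist_triangle (u := v i) (v := v (i + 1)) (w := v (i + 2))
    have h2 := hG.1.dist_triangle (u := v i) (v := v (i + 2)) (w := v (i + 3))
    have h3 := d1 (i + 1)
    have h4 := d1 (i + 2)
    rw [add_assoc] at h3 h4
    have e1 : (1 + 1 : ZMod 6) = 2 := rfl
    have e2 : (2 + 1 : ZMod 6) = 3 := rfl
    rw [e1] at h3
    rw [e2] at h4
    rw [d1, h3] at h1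
    rw [hdist, h4] at h2
    omega
  have d4 : ∀ i, G.dist (v i) (v (i + 4)) = 2 := by
    intro i
    have := d2 (i + 4)
    rw [add_assoc, show (4 + 2 : ZMod 6) = 0 from rfl, add_zero] at this
    rwa [G.dist_comm]
  have d5 : ∀ i, G.dist (v i) (v (i + 5)) = 1 := by
    intro i
    have := d1 (i + 5)
    rw [add_assoc, show (5 + 1 : ZMod 6) = 0 from rfl, add_zero] at this
    rwa [G.dist_comm]
  have hiso : IsIsometric ((⊤ : G.Subgraph).induce (Set.range v)) := by
    refine isIsometric_induce ⟨v 0, 0, rfl⟩ ?_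
    rintro _ ⟨i, rfl⟩ _ ⟨j, rfl⟩ hij
    obtain ⟨k, rfl⟩ : ∃ k, j = i + k := ⟨j - i, by ring⟩
    have up : ∀ k : ZMod 6, G.dist (v (i + 1)) (v (i + (1 + k))) + 1 =
        G.dist (v i) (v (i + (1 + k))) →
        ∃ r ∈ Set.range v, G.Adj (v i) r ∧
          G.dist r (v (i + (1 + k))) + 1 =
        G.dist (v i) (v (i + (1 + k))) :=
      fun k hk => ⟨v (i + 1), ⟨_, rfl⟩, hadj i, hk⟩
    have down : ∀ k : ZMod 6, G.dist (v (i + 5)) (v (i + (5 + k))) + 1 =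
        G.dist (v i) (v (i + (5 + k))) →
        ∃ r ∈ Set.range v, G.Adj (v i) r ∧
          G.dist r (v (i + (5 + k))) + 1 = G.dist (v i) (v (i + (5 + k))) := by
      refine fun k hk => ⟨v (i + 5), ⟨_, rfl⟩, SimpleGraph.dist_eq_one_iff_adj.1 (d5 i), hk⟩
    rcases zmod_six_cases k with rfl | rfl | rfl | rfl | rfl | rfl
    · exact absurd (by rw [add_zero]) hij
    · exact up 0 (by rw [← add_assoc, add_zero, SimpleGraph.dist_self, d1])
    · exact up 1 (by rw [← add_assoc, d1, add_assoc, show (1 + 1 : ZMod 6) = 2 from rfl, d2])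
    · exact up 2 (by rw [← add_assoc, d2, add_assoc, show (1 + 2 : ZMod 6) = 3 from rfl, hdist])
    · exact down 5 (by rw [← add_assoc, d5, add_assoc, show (5 + 5 : ZMod 6) = 4 from rfl, d4])
    · exact down 0 (by rw [← add_assoc, add_zero, SimpleGraph.dist_self, d5])
  obtain ⟨⟨_, i, rfl⟩, h1, h2, h3⟩ := (hG.2 _ hiso).2 ⟨v 0, 0, rfl⟩ ⟨v 2, 2, rfl⟩ ⟨v 4, 4, rfl⟩
  simp only [hiso.2] at h1 h2 h3
  have e02 : G.dist (v 0) (v 2) = 2 := d2 0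
  have e04 : G.dist (v 0) (v 4) = 2 := d4 0
  have e24 : G.dist (v 2) (v 4) = 2 := d2 2
  have e03 : G.dist (v 0) (v 3) = 3 := hdist 0
  have e25 : G.dist (v 2) (v 5) = 3 := hdist 2
  have e41 : G.dist (v 1) (v 4) = 3 := hdist 1
  have e20 : G.dist (v 2) (v 0) = 2 := d4 2
  have e42 : G.dist (v 4) (v 2) = 2 := d4 4
  rcases zmod_six_cases i with rfl | rfl | rfl | rfl | rfl | rfl
  · omega
  · omega
  · omega
  · omega
  · omega
  · omega

/-- An orientable graph does not contain `K_{3,3}` minus the edge `a₃b₃`: its 4-circuits force the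
two orientations of an edge to be equivalent. -/
theorem IsOrientable.no_thickK (hG : IsOrientable G) {a₁ a₂ a₃ b₁ b₂ b₃ : V}
    (ha : a₁ ≠ a₂) (ha' : a₁ ≠ a₃) (ha'' : a₂ ≠ a₃) (hb : b₁ ≠ b₂) (hb' : b₁ ≠ b₃) (hb'' : b₂ ≠ b₃)
    (h₁₁ : G.Adj a₁ b₁) (h₁₂ : G.Adj a₁ b₂) (h₁₃ : G.Adj a₁ b₃) (h₂₁ : G.Adj a₂ b₁)
    (h₂₂ : G.Adj a₂ b₂) (h₂₃ : G.Adj a₂ b₃) (h₃₁ : G.Adj a₃ b₁) (h₃₂ : G.Adj a₃ b₂) : False := by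
  obtain ⟨o, ho, hc⟩ := hG
  -- an edge at `a` and the opposite edge at `a'` point to different colour classes
  have key : ∀ {a a' b b'}, a ≠ a' → b ≠ b' → G.Adj a b → G.Adj a b' → G.Adj a' b → G.Adj a' b' →
      (o a b ↔ ¬ o a' b') := by
    intro a a' b b' ha hb h1 h2 h3 h4
    have := (hc a b a' b' ⟨h1, h3.symm, h4, h2.symm, ha, hb⟩).1
    have := ho a' b' h4
    tauto
  have k1 := key ha hb h₁₁ h₁₂ h₂₁ h₂₂
  have k2 := key ha hb' h₁₁ h₁₃ h₂₁ h₂₃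
  have k3 := key ha hb''.symm h₁₃ h₁₂ h₂₃ h₂₂
  have k4 := key ha hb.symm h₁₂ h₁₁ h₂₂ h₂₁
  have k5 := key ha hb'' h₁₂ h₁₃ h₂₂ h₂₃
  have k6 := key ha' hb h₁₁ h₁₂ h₃₁ h₃₂
  have k7 := key ha'' hb h₂₁ h₂₂ h₃₁ h₃₂
  tauto

end Induced

section Frame

variable {V : Type*} {G : SimpleGraph V}

theorem IsModular.dist_eq_three (hG : IsModular G) {c x y z w : V} (h1 : G.Adj x y)
    (h2 : G.Adj y z) (h3 : G.Adj z w) (hodd : Odd (G.dist c x + G.dist c w)) (h : ¬ G.Adj x w) :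
    G.dist x w = 3 := by
  have t1 := hG.1.dist_triangle (u := x) (v := y) (w := w)
  have t2 := hG.1.dist_triangle (u := y) (v := z) (w := w)
  rw [SimpleGraph.dist_eq_one_iff_adj.2 h1] at t1
  rw [SimpleGraph.dist_eq_one_iff_adj.2 h2, SimpleGraph.dist_eq_one_iff_adj.2 h3] at t2
  have t3 : G.dist x w ≠ 1 := fun e => h (SimpleGraph.dist_eq_one_iff_adj.1 e)
  have t4 := Nat.even_iff.1 (hG.even_dist x w c)
  have t5 := Nat.odd_iff.1 hodd
  omega

/-- Every closed walk of length six has two opposite vertices that are adjacent. Without such a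
diagonal, opposite vertices would be at distance three and the hexagon isometric. -/
theorem IsHereditaryModular.exists_diagonal (hG : IsHereditaryModular G)
    {v₀ v₁ v₂ v₃ v₄ v₅ : V} (h₀ : G.Adj v₀ v₁) (h₁ : G.Adj v₁ v₂) (h₂ : G.Adj v₂ v₃)
    (h₃ : G.Adj v₃ v₄) (h₄ : G.Adj v₄ v₅) (h₅ : G.Adj v₅ v₀) :
    G.Adj v₀ v₃ ∨ G.Adj v₁ v₄ ∨ G.Adj v₂ v₅ := by
  by_contra! h
  obtain ⟨h03, h14, h25⟩ := h
  have hm := hG.isModular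
  have step : ∀ {x y}, G.Adj x y → Odd (G.dist v₀ x + G.dist v₀ y) := by
    intro x y hxy
    rw [Nat.odd_iff]
    rcases hm.low_or_low v₀ hxy with e | e <;> have := e.2 <;> omega
  have odd3 : ∀ {x y z w}, G.Adj x y → G.Adj y z → G.Adj z w → Odd (G.dist v₀ x + G.dist v₀ w) := by
    intro x y z w a b d
    have a := Nat.odd_iff.1 (step a)
    have b := Nat.odd_iff.1 (step b)
    have d := Nat.odd_iff.1 (step d)
    rw [Nat.odd_iff]
    omega
  have d03 := hm.dist_eq_three h₀ h₁ h₂ (odd3 h₀ h₁ h₂) h03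
  have d14 := hm.dist_eq_three h₁ h₂ h₃ (odd3 h₁ h₂ h₃) h14
  have d25 := hm.dist_eq_three h₂ h₃ h₄ (odd3 h₂ h₃ h₄) h25
  let v : ZMod 6 → V := (![v₀, v₁, v₂, v₃, v₄, v₅] : Fin 6 → V)
  refine hG.no_hexagon v (fun i => ?_) (fun i => ?_)
  · rcases zmod_six_cases i with rfl | rfl | rfl | rfl | rfl | rfl
    exacts [h₀, h₁, h₂, h₃, h₄, h₅]
  · rcases zmod_six_cases i with rfl | rfl | rfl | rfl | rfl | rfl
    exacts [d03, d14, d25, (G.dist_comm).trans d03, (G.dist_comm).trans d14,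
      (G.dist_comm).trans d25]

/-- Two common lower neighbours `p`, `q` of `u` and `w` would, with a common lower neighbour `r` of
`p` and `q`, give a `K_{3,3}` with colour classes `u, w, r` and `p, q, x` and at most the edge `rx`
missing. -/
theorem IsFrame.pole_unique (hG : IsFrame G) {c x u w p q : V} (hu : Low G c u x)
    (hw : Low G c w x) (h : u ≠ w) (hpu : Low G c p u) (hpw : Low G c p w) (hqu : Low G c q u)
    (hqw : Low G c q w) : p = q := by
  by_contra hpq
  obtain ⟨r, hrp, hrq⟩ := hG.1.isModular.exists_meet hpu hqu hpq
  have l1 := hpu.2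
  have l2 := hu.2
  have l3 := hrp.2
  have l4 := hw.2
  have l5 := hqu.2
  refine hG.2.no_thickK (a₁ := u) (a₂ := w) (a₃ := r) (b₁ := p) (b₂ := q) (b₃ := x) h ?_ ?_ hpq
    ?_ ?_ hpu.1.symm hqu.1.symm hu.1 hpw.1.symm hqw.1.symm hw.1 hrp.1 hrq.1
  all_goals rintro rfl; omega

/-- The poles `p`, `s`, `t` of the three pairs among `u`, `w`, `v` give a hexagon `u p w t v s`;
each of its diagonals makes `p` a neighbour of `v`, by uniqueness of poles. -/
theorem IsFrame.low_pole (hG : IsFrame G) {c x u w v p : V} (hu : Low G c u x)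
    (hw : Low G c w x) (h : u ≠ w) (hpu : Low G c p u) (hpw : Low G c p w) (hv : Low G c v x) :
    Low G c p v := by
  have hm := hG.1.isModular
  by_cases huv : u = v
  · exact huv ▸ hpu
  by_cases hwv : w = v
  · exact hwv ▸ hpw
  suffices G.Adj p v from ⟨this, by have := hpu.2; have := hu.2; have := hv.2; omega⟩
  obtain ⟨s, hsu, hsv⟩ := hm.exists_meet hu hv huv
  obtain ⟨t, htw, htv⟩ := hm.exists_meet hw hv hwv
  rcases hG.1.exists_diagonal hpu.1.symm hpw.1 htw.1.symm htv.1 hsv.1.symm hsu.1 with e | e | e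
  · have htu : Low G c t u := ⟨e.symm, by have := htw.2; have := hw.2; have := hu.2; omega⟩
    exact hG.pole_unique hu hw h hpu hpw htu htw ▸ htv.1
  · exact e
  · have hsw : Low G c s w := ⟨e.symm, by have := hsu.2; have := hw.2; have := hu.2; omega⟩
    exact hG.pole_unique hu hw h hpu hpw hsu hsw ▸ hsv.1

/-- In the hexagon `x u s r t w`, the diagonal `xr` would skip levels, and the other two contradict
the uniqueness of the pole `p`. -/
theorem IsFrame.no_wings (hG : IsFrame G) {c x u w p s t r : V} (hu : Low G c u x)
    (hw : Low G c w x) (h : u ≠ w) (hpu : Low G c p u) (hpw : Low G c p w) (hsu : Low G c s u)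
    (hs : s ≠ p) (htw : Low G c t w) (ht : t ≠ p) (hrs : Low G c r s) (hrt : Low G c r t) :
    False := by
  have l1 := hu.2
  have l2 := hw.2
  have l3 := hsu.2
  have l4 := hrs.2
  have l5 := htw.2
  rcases hG.1.exists_diagonal hu.1.symm hsu.1.symm hrs.1.symm hrt.1 htw.1 hw.1 with e | e | e
  · have := SimpleGraph.dist_eq_one_iff_adj.2 e
    have := hG.1.1.dist_triangle (u := c) (v := r) (w := x)
    rw [SimpleGraph.dist_comm (u := r)] at this
    omega
  · exact ht (hG.pole_unique hu hw h ⟨e.symm, by omega⟩ htw hpu hpw)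
  · exact hs (hG.pole_unique hu hw h hsu ⟨e, by omega⟩ hpu hpw)

theorem IsFrame.isPolar (hG : IsFrame G) (c : V) : IsPolar G c where
  low_or_low h := hG.1.isModular.low_or_low c h
  exists_low h := exists_low_of_ne hG.1.1 h
  exists_meet hu hw h := hG.1.isModular.exists_meet hu hw h
  low_pole hu hw h hpu hpw hv := hG.low_pole hu hw h hpu hpw hv
  pole_unique hu hw h hpu hpw hqu hqw := hG.pole_unique hu hw h hpu hpw hqu hqw
  no_wings hu hw h hpu hpw hsu hs htw ht hrs hrt :=
    hG.no_wings hu hw h hpu hpw hsu hs htw ht hrs hrt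

end Frame

/-! ### Distances and medians in Cartesian products -/

section Product

variable {ι : Type*} [Fintype ι] {T : ι → Type*} {H : ∀ i, SimpleGraph (T i)}

theorem sum_dist_le_length (hH : ∀ i, (H i).Connected) {s t : ∀ i, T i}
    (p : (cartesianProduct H).Walk s t) : ∑ i, (H i).dist (s i) (t i) ≤ p.length := by
  induction p with
  | nil => simp
  | @cons s r t h p ih =>
    have h1 : ∑ j, (H j).dist (s j) (r j) = 1 := by
      obtain ⟨i, hi, hne⟩ := h
      rw [Finset.sum_eq_single i (fun j _ hj => by rw [hne j hj, SimpleGraph.dist_self])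
        (fun h => absurd (Finset.mem_univ i) h), SimpleGraph.dist_eq_one_iff_adj.2 hi]
    calc ∑ j, (H j).dist (s j) (t j)
        ≤ ∑ j, ((H j).dist (s j) (r j) + (H j).dist (r j) (t j)) :=
          Finset.sum_le_sum fun j _ => (hH j).dist_triangle
      _ ≤ _ := by
          rw [Finset.sum_add_distrib, h1, SimpleGraph.Walk.length_cons]
          omega

theorem exists_walk_length_eq_sum_dist (hH : ∀ i, (H i).Connected) (s t : ∀ i, T i) :
    ∃ p : (cartesianProduct H).Walk s t, p.length = ∑ i, (H i).dist (s i) (t i) := by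
  classical
  refine exists_walk_length_eq (f := fun s : ∀ i, T i => ∑ i, (H i).dist (s i) (t i))
    (by simp) (fun s hst => ?_) s
  obtain ⟨i, hi⟩ := Function.ne_iff.1 hst
  obtain ⟨z, hz, hd⟩ := exists_adj_dist_add_one (hH i) hi
  refine ⟨Function.update s i z, ⟨i, by rwa [Function.update_self],
    fun j hj => (Function.update_of_ne hj _ _).symm⟩, ?_⟩
  rw [← Finset.add_sum_erase _ _ (Finset.mem_univ i),
    ← Finset.add_sum_erase _ _ (Finset.mem_univ i),
    ← hd, Function.update_self, Finset.sum_congr rfl (fun j hj => by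
      rw [Function.update_of_ne (Finset.ne_of_mem_erase hj)])]
  omega

theorem dist_cartesianProduct (hH : ∀ i, (H i).Connected) (s t : ∀ i, T i) :
    (cartesianProduct H).dist s t = ∑ i, (H i).dist (s i) (t i) := by
  obtain ⟨p, hp⟩ := exists_walk_length_eq_sum_dist hH s t
  obtain ⟨q, hq⟩ := p.reachable.exists_walk_length_eq_dist
  exact le_antisymm (hp ▸ SimpleGraph.dist_le p) (hq ▸ sum_dist_le_length hH q)

theorem connected_cartesianProduct (hH : ∀ i, (H i).Connected) :
    (cartesianProduct H).Connected where
  preconnected s t := (exists_walk_length_eq_sum_dist hH s t).choose.reachable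
  nonempty := ⟨fun i => (hH i).nonempty.some⟩

/-- `z` is a median of `a`, `b`, `c`. -/
def IsMedian {V : Type*} (G : SimpleGraph V) (a b c z : V) : Prop :=
  G.dist a z + G.dist z b = G.dist a b ∧ G.dist a z + G.dist z c = G.dist a c ∧
    G.dist b z + G.dist z c = G.dist b c

theorem isMedian_apply (hH : ∀ i, (H i).Connected) {a b c z : ∀ i, T i}
    (h : IsMedian (cartesianProduct H) a b c z) (i : ι) :
    IsMedian (H i) (a i) (b i) (c i) (z i) := by
  have key : ∀ {a b : ∀ i, T i}, (cartesianProduct H).dist a z + (cartesianProduct H).dist z b =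
      (cartesianProduct H).dist a b →
      (H i).dist (a i) (z i) + (H i).dist (z i) (b i) = (H i).dist (a i) (b i) := by
    intro a b h
    simp only [dist_cartesianProduct hH, ← Finset.sum_add_distrib] at h
    exact ((Finset.sum_eq_sum_iff_of_le fun j _ => (hH j).dist_triangle).1 h.symm i
      (Finset.mem_univ i)).symm
  exact ⟨key h.1, key h.2.1, key h.2.2⟩

end Product

section Median

variable {V : Type*} {G : SimpleGraph V}

theorem eq_of_dist_add_dist (hG : G.Connected) {a b z : V} (hab : a = b)
    (h : G.dist a z + G.dist z b = G.dist a b) : z = a := by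
  rw [hab, SimpleGraph.dist_self] at h
  rw [hab]
  exact hG.dist_eq_zero_iff.1 (by omega)

theorem IsMedian.eq_of_low (hG : G.Connected) {c x x' z : V} (h : Low G c x' x)
    (hz : IsMedian G x c x' z) : z = x' := by
  have h1 := SimpleGraph.dist_eq_one_iff_adj.2 h.1
  have h2 := h.2
  obtain ⟨e1, e2, e3⟩ := hz
  rw [G.dist_comm (u := z) (v := c), G.dist_comm (u := x) (v := c)] at e1
  rw [G.dist_comm (u := x) (v := x'), h1] at e2
  exact hG.dist_eq_zero_iff.1 (by omega)

theorem IsMedian.eq_of_adj (hG : IsModular G) {x u w z : V} (hu : G.Adj u x) (hw : G.Adj w x)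
    (h : u ≠ w) (hz : IsMedian G u w x z) : z = x := by
  have h1 := SimpleGraph.dist_eq_one_iff_adj.2 hu
  have h2 := SimpleGraph.dist_eq_one_iff_adj.2 hw
  have h3 := hG.dist_eq_two hu hw h
  obtain ⟨e1, e2, e3⟩ := hz
  rw [G.dist_comm (u := z) (v := w)] at e1
  exact hG.1.dist_eq_zero_iff.1 (by omega)

end Median

/-! ### Reduction to pairs of factors -/

section MedianClosed

variable {ι : Type*} {T : ι → Type*} {H : ∀ i, SimpleGraph (T i)} {S : Set (∀ i, T i)}

/-- Every three elements of `S` have a coordinatewise median in `S`. -/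
def IsMedianClosed (H : ∀ i, SimpleGraph (T i)) (S : Set (∀ i, T i)) : Prop :=
  ∀ s₀ ∈ S, ∀ s₁ ∈ S, ∀ s₂ ∈ S, ∃ z ∈ S, ∀ i, IsMedian (H i) (s₀ i) (s₁ i) (s₂ i) (z i)

/-- The projection of `S` to the coordinates `i` and `j`, as a relation. -/
def pairRel (S : Set (∀ i, T i)) (i j : ι) (x : T i) (y : T j) : Prop :=
  ∃ v ∈ S, v i = x ∧ v j = y

theorem pairRel_comm {i j : ι} {x : T i} {y : T j} : pairRel S i j x y ↔ pairRel S j i y x := by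
  simp only [pairRel, and_comm]

/-- If `S` contains, for each `i`, the full layer through `c i` in direction `i`, then the slices
of its projections are closed with respect to the base points given by these layers: the closure
properties follow by taking medians with elements of the layers. -/
theorem isLowClosed_pairRel [DecidableEq ι] (hH : ∀ i, IsModular (H i)) (hS : IsMedianClosed H S)
    {c : ι → ∀ i, T i} (hc : ∀ i a, Function.update (c i) i a ∈ S) {i j : ι} (hij : i ≠ j)
    (y : T j) : IsLowClosed (H i) (c j i) {x | pairRel S i j x y} where
  base := ⟨_, hc j y, by rw [Function.update_of_ne hij], by rw [Function.update_self]⟩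
  down := by
    rintro x' x h ⟨v, hv, rfl, rfl⟩
    obtain ⟨z, hz, hmed⟩ := hS v hv _ (hc j (v j)) _ (hc i x')
    have hi := hmed i
    have hj := hmed j
    rw [Function.update_of_ne hij, Function.update_self] at hi
    exact ⟨z, hz, hi.eq_of_low (hH i).1 h,
      eq_of_dist_add_dist (hH j).1 (by rw [Function.update_self]) hj.1⟩
  join := by
    rintro x _ _ hu hw h ⟨u, huS, rfl, rfl⟩ ⟨w, hwS, rfl, hwy⟩
    obtain ⟨z, hz, hmed⟩ := hS u huS w hwS _ (hc i x)
    have hi := hmed i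
    rw [Function.update_self] at hi
    exact ⟨z, hz, hi.eq_of_adj (hH i) hu.1 hw.1 h, eq_of_dist_add_dist (hH j).1 hwy.symm (hmed j).1⟩

theorem isLowClosedRel_pairRel [DecidableEq ι] (hH : ∀ i, IsModular (H i))
    (hS : IsMedianClosed H S) {c : ι → ∀ i, T i} (hc : ∀ i a, Function.update (c i) i a ∈ S)
    {i j : ι} (hij : i ≠ j) :
    IsLowClosedRel (H i) (H j) (c j i) (c i j) (pairRel S i j) := by
  refine ⟨isLowClosed_pairRel hH hS hc hij, fun x => ?_⟩
  simp only [pairRel_comm (i := i)]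
  exact isLowClosed_pairRel hH hS hc hij.symm x

/-- A set closed under coordinatewise medians is determined by its projections to pairs of
coordinates. By induction, every choice of coordinates of `v` is realized in `S`: if elements of
`S` agree with `v` on `J` up to one of three given coordinates each, their median agrees with `v`
on `J`, since in each coordinate at least two of them do. -/
theorem IsMedianClosed.mem_of_pairRel [Finite ι] (hH : ∀ i, (H i).Connected)
    (hS : IsMedianClosed H S) (hne : S.Nonempty) {v : ∀ i, T i}
    (hv : ∀ i j, pairRel S i j (v i) (v j)) : v ∈ S := by
  classical
  have key : ∀ J : Finset ι, ∃ v' ∈ S, ∀ i ∈ J, v' i = v i := by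
    intro J
    induction J using Finset.strongInduction with
    | H J ih =>
      by_cases h2 : 2 < J.card
      · obtain ⟨i, hi, j, hj, l, hl, hij, hil, hjl⟩ := Finset.two_lt_card.1 h2
        obtain ⟨a, ha, hai⟩ := ih _ (Finset.erase_ssubset hi)
        obtain ⟨b, hb, hbj⟩ := ih _ (Finset.erase_ssubset hj)
        obtain ⟨c, hc, hcl⟩ := ih _ (Finset.erase_ssubset hl)
        obtain ⟨z, hz, hmed⟩ := hS a ha b hb c hc
        refine ⟨z, hz, fun m hm => ?_⟩
        simp only [Finset.mem_erase] at hai hbj hcl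
        obtain ⟨h1, h2, h3⟩ := hmed m
        by_cases hmi : m = i
        · have hbm := hbj m ⟨hmi ▸ hij, hm⟩
          rw [← hbm]
          exact eq_of_dist_add_dist (hH m) (hbm.trans (hcl m ⟨hmi ▸ hil, hm⟩).symm) h3
        have ham := hai m ⟨hmi, hm⟩
        rw [← ham]
        by_cases hmj : m = j
        · exact eq_of_dist_add_dist (hH m) (ham.trans (hcl m ⟨hmj ▸ hjl, hm⟩).symm) h2
        · exact eq_of_dist_add_dist (hH m) (ham.trans (hbj m ⟨hmj, hm⟩).symm) h1
      · obtain h | h | h : J.card = 0 ∨ J.card = 1 ∨ J.card = 2 := by omega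
        · obtain rfl := Finset.card_eq_zero.1 h
          obtain ⟨s, hs⟩ := hne
          exact ⟨s, hs, by simp⟩
        · obtain ⟨i, rfl⟩ := Finset.card_eq_one.1 h
          obtain ⟨s, hs, hsi, -⟩ := hv i i
          exact ⟨s, hs, by simpa using hsi⟩
        · obtain ⟨i, j, -, rfl⟩ := Finset.card_eq_two.1 h
          obtain ⟨s, hs, hsi, hsj⟩ := hv i j
          exact ⟨s, hs, by simpa using ⟨hsi, hsj⟩⟩
  have := Fintype.ofFinite ι
  obtain ⟨v', hv', h⟩ := key Finset.univ
  obtain rfl : v' = v := funext fun i => h i (Finset.mem_univ i)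
  exact hv'

/-- An endomorphism of the box product of two factors acts on the whole product. -/
theorem exists_hom_of_boxProd [DecidableEq ι] {i j : ι} (hij : i ≠ j) (γ : T i × T j → T i × T j)
    (hγ : ∀ z z', (H i □ H j).Adj z z' → (H i □ H j).Adj (γ z) (γ z')) :
    ∃ ρ : cartesianProduct H →g cartesianProduct H, ∀ v,
      (ρ v i, ρ v j) = γ (v i, v j) ∧ ∀ m, m ≠ i → m ≠ j → ρ v m = v m := by
  let ρ : (∀ i, T i) → ∀ i, T i := fun v =>
    Function.update (Function.update v i (γ (v i, v j)).1) j (γ (v i, v j)).2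
  have hi : ∀ v, ρ v i = (γ (v i, v j)).1 := fun v => by simp [ρ, hij]
  have hj : ∀ v, ρ v j = (γ (v i, v j)).2 := fun v => by simp [ρ]
  have hm : ∀ v m, m ≠ i → m ≠ j → ρ v m = v m := fun v m h h' => by simp [ρ, h, h']
  refine ⟨⟨ρ, fun {v w} h => ?_⟩, fun v => ⟨Prod.ext (hi v) (hj v), hm v⟩⟩
  obtain ⟨m, hadj, hne⟩ := h
  by_cases hmij : m = i ∨ m = j
  · have hbox : (H i □ H j).Adj (v i, v j) (w i, w j) := by
      rw [SimpleGraph.boxProd_adj]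
      rcases hmij with rfl | rfl
      · exact .inl ⟨hadj, hne j hij.symm⟩
      · exact .inr ⟨hadj, hne i hij⟩
    have hrest : ∀ l, l ≠ i → l ≠ j → ρ v l = ρ w l := fun l h h' => by
      rw [hm v l h h', hm w l h h']
      exact hne l (by rcases hmij with rfl | rfl <;> assumption)
    have h := hγ _ _ hbox
    rw [SimpleGraph.boxProd_adj, ← hi, ← hj, ← hi, ← hj] at h
    rcases h with ⟨h, h'⟩ | ⟨h, h'⟩
    · exact ⟨i, h, fun l hl => if hlj : l = j then hlj ▸ h' else hrest l hl hlj⟩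
    · exact ⟨j, h, fun l hl => if hli : l = i then hli ▸ h' else hrest l hli hl⟩
  · push Not at hmij
    have hvi := hne i hmij.1.symm
    have hvj := hne j hmij.2.symm
    refine ⟨m, by rwa [hm v m hmij.1 hmij.2, hm w m hmij.1 hmij.2], fun l hl => ?_⟩
    by_cases hli : l = i
    · subst hli
      rw [hi, hi, hvi, hvj]
    by_cases hlj : l = j
    · subst hlj
      rw [hj, hj, hvi, hvj]
    · rw [hm v l hli hlj, hm w l hli hlj, hne l hl]

theorem exists_hom_pairRel [DecidableEq ι] [∀ i, Finite (T i)] (hH : ∀ i, IsFrame (H i))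
    (hS : IsMedianClosed H S) {c : ι → ∀ i, T i} (hc : ∀ i a, Function.update (c i) i a ∈ S)
    {i j : ι} (hij : i ≠ j) :
    ∃ ρ : cartesianProduct H →g cartesianProduct H, (∀ v ∈ S, ρ v = v) ∧
      ∀ v, pairRel S i j (ρ v i) (ρ v j) ∧ ∀ m, m ≠ i → m ≠ j → ρ v m = v m := by
  obtain ⟨γ, hmem, hfix, hadj⟩ := exists_retraction_of_isLowClosedRel
    ((hH i).isPolar (c j i)) ((hH j).isPolar (c i j))
    (isLowClosedRel_pairRel (fun i => (hH i).1.isModular) hS hc hij)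
  obtain ⟨ρ, hρ⟩ := exists_hom_of_boxProd (H := H) hij γ hadj
  refine ⟨ρ, fun v hv => ?_, fun v => ⟨?_, (hρ v).2⟩⟩
  · have h := (hρ v).1
    rw [hfix (v i, v j) ⟨v, hv, rfl, rfl⟩, Prod.mk.injEq] at h
    funext m
    by_cases hi : m = i
    · exact hi ▸ h.1
    by_cases hj : m = j
    · exact hj ▸ h.2
    · exact (hρ v).2 m hi hj
  · have h := hmem (v i, v j)
    rwa [← (hρ v).1] at h

/-- A set closed under coordinatewise medians that contains a full layer in each direction is the
image of an endomorphism of the product that fixes it. -/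
theorem exists_hom_retraction [Finite ι] [∀ i, Finite (T i)] (hH : ∀ i, IsFrame (H i))
    (hS : IsMedianClosed H S) (hne : S.Nonempty)
    (hlayer : ∀ i, ∃ c : ∀ i, T i, ∀ t : ∀ i, T i, (∀ j, j ≠ i → t j = c j) → t ∈ S) :
    ∃ φ : cartesianProduct H →g cartesianProduct H, (∀ v ∈ S, φ v = v) ∧ ∀ v, φ v ∈ S := by
  classical
  have := Fintype.ofFinite ι
  have := fun i => Fintype.ofFinite (T i)
  choose c hc using hlayer
  have hc : ∀ i a, Function.update (c i) i a ∈ S := fun i a =>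
    hc i _ fun j hj => Function.update_of_ne hj ..
  have hconn : ∀ i, (H i).Connected := fun i => (hH i).1.1
  set K := cartesianProduct H
  -- the total distance between the images under an endomorphism and the elements of `S`
  let defect : (K →g K) → ℕ := fun φ => ∑ v, ∑ u : S, K.dist (φ v) u
  obtain ⟨φ, hφ, hmin⟩ := WellFounded.has_min (measure defect).wf {φ | ∀ v ∈ S, φ v = v}
    ⟨SimpleGraph.Hom.id, fun v _ => rfl⟩
  refine ⟨φ, hφ, fun v => ?_⟩
  by_contra hv
  obtain ⟨i, j, hij⟩ : ∃ i j, ¬ pairRel S i j (φ v i) (φ v j) := by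
    by_contra! h
    exact hv (hS.mem_of_pairRel hconn hne h)
  have hne : i ≠ j := by
    rintro rfl
    exact hij ⟨_, hc i (φ v i), Function.update_self .., Function.update_self ..⟩
  obtain ⟨ρ, hfix, hρ⟩ := exists_hom_pairRel hH hS hc hne
  -- `ρ` is nonexpansive and fixes `S`, so composing with it does not increase any summand
  have hle : ∀ w (u : S), K.dist (ρ (φ w)) u ≤ K.dist (φ w) u := fun w u => by
    have := dist_map_le (connected_cartesianProduct hconn) ρ (φ w) u
    rwa [hfix u u.2] at this
  obtain ⟨⟨u, hu, hui, huj⟩, hrest⟩ := hρ (φ v)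
  have hlt : K.dist (ρ (φ v)) u < K.dist (φ v) u := by
    have hle' : ∀ m, (H m).dist (ρ (φ v) m) (u m) ≤ (H m).dist (φ v m) (u m) := fun m => by
      by_cases hmi : m = i
      · subst hmi
        rw [hui, SimpleGraph.dist_self]
        exact Nat.zero_le _
      by_cases hmj : m = j
      · subst hmj
        rw [huj, SimpleGraph.dist_self]
        exact Nat.zero_le _
      · rw [hrest m hmi hmj]
    have hdiff : φ v i ≠ u i ∨ φ v j ≠ u j := by
      by_contra! h
      exact hij ⟨u, hu, h.1.symm, h.2.symm⟩
    rw [dist_cartesianProduct hconn, dist_cartesianProduct hconn]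
    rcases hdiff with h | h
    · refine Finset.sum_lt_sum (fun m _ => hle' m) ⟨i, Finset.mem_univ i, ?_⟩
      rw [← hui, SimpleGraph.dist_self]
      exact (hconn i).pos_dist_of_ne h
    · refine Finset.sum_lt_sum (fun m _ => hle' m) ⟨j, Finset.mem_univ j, ?_⟩
      rw [← huj, SimpleGraph.dist_self]
      exact (hconn j).pos_dist_of_ne h
  refine hmin (ρ.comp φ) (fun w hw => ?_) ?_
  · change ρ (φ w) = w
    rw [hφ w hw, hfix w hw]
  · exact Finset.sum_lt_sum (fun w _ => Finset.sum_le_sum fun u _ => hle w u)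
      ⟨v, Finset.mem_univ v, Finset.sum_lt_sum (fun u _ => hle v u)
        ⟨⟨u, hu⟩, Finset.mem_univ _, hlt⟩⟩

end MedianClosed

section Subgraph

variable {ι : Type*} {T : ι → Type*} {H : ∀ i, SimpleGraph (T i)}
  {K' : (cartesianProduct H).Subgraph}

theorem isMedianClosed_verts [Fintype ι] (hH : ∀ i, (H i).Connected)
    (hiso : IsIsometric K') (hmod : IsModular K'.coe) : IsMedianClosed H K'.verts := by
  intro a ha b hb c hc
  obtain ⟨z, h⟩ := hmod.2 ⟨a, ha⟩ ⟨b, hb⟩ ⟨c, hc⟩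
  simp only [hiso.2] at h
  exact ⟨z, z.2, isMedian_apply hH h⟩

/-- A layer isomorphic to the finite factor `H i` is full: a vertex of the layer is determined by
its `i`-th coordinate, and there are as many vertices as coordinates. -/
theorem mem_verts_of_layer_iso {i : ι} [Finite (T i)] {c : ∀ j, T j} (e : layer K' i c ≃g H i)
    {t : ∀ i, T i} (ht : ∀ j, j ≠ i → t j = c j) : t ∈ K'.verts := by
  let f : T i → T i := fun a => (e.symm a).1.1 i
  have hf : Function.Injective f := fun a b hab => e.symm.injective (Subtype.ext (Subtype.ext (by
    funext j
    by_cases hj : j = i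
    · subst hj
      exact hab
    · rw [(e.symm a).2 j hj, (e.symm b).2 j hj])))
  obtain ⟨a, ha⟩ := Finite.surjective_of_injective hf (t i)
  have : t = (e.symm a).1.1 := by
    funext j
    by_cases hj : j = i
    · subst hj
      exact ha.symm
    · rw [ht j hj, (e.symm a).2 j hj]
  exact this ▸ (e.symm a).1.2

end Subgraph

end ModularRetract

theorem theorem4 {k : ℕ} {T : Fin k → Type*} [∀ i, Finite (T i)]
    (H : ∀ i, SimpleGraph (T i)) (hH : ∀ i, ModularRetract.IsFrame (H i))
    (K' : (ModularRetract.cartesianProduct H).Subgraph)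
    (hiso : ModularRetract.IsIsometric K')
    (hmod : ModularRetract.IsModular K'.coe)
    (hlayer : ∀ i : Fin k, ∃ c : ∀ j, T j, Nonempty (ModularRetract.layer K' i c ≃g H i)) :
    ∃ γ : (∀ i, T i) → K'.verts, ModularRetract.IsRetraction K' γ := by
  obtain ⟨φ, hfix, hmem⟩ := ModularRetract.exists_hom_retraction hH
    (ModularRetract.isMedianClosed_verts (fun i => (hH i).1.1) hiso hmod)
    (Set.nonempty_coe_sort.1 hmod.1.nonempty)
    (fun i => by
      obtain ⟨c, ⟨e⟩⟩ := hlayer i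
      exact ⟨c, fun t ht => ModularRetract.mem_verts_of_layer_iso e ht⟩)
  refine ⟨fun v => ⟨φ v, hmem v⟩, fun v => Subtype.ext (hfix v v.2), fun u v huv => ?_⟩
  -- vertices of an isometric subgraph that are adjacent in the whole graph are adjacent in it
  have h := hiso.2 ⟨φ u, hmem u⟩ ⟨φ v, hmem v⟩
  rw [SimpleGraph.dist_eq_one_iff_adj.2 (φ.map_adj huv), SimpleGraph.dist_eq_one_iff_adj] at h
  exact h
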